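/- For $\alpha>0$ and a real-valued random variable $Y$ let $\|Y\|_{\psi_\alpha}:=\inf\{\eta>0:\ \mathbb{E}[\psi_\alpha(|Y|/\eta)]\le 1\}\in[0,\infty]$, where $\psi_\alpha(x)=\exp(x^\alpha)-1$ for $x\ge 0$ (and $\inf\emptyset=\infty$). For $v\in\mathbb{R}^q$ let $\|v\|_\infty=\max_{1\le j\le q}|v(j)|$. Theorem. For every $\alpha>0$ there is a constant $C_\alpha>0$, depending only on $\alpha$, such that the following holds. Let $n,q\ge 1$, and let $X_1,\dots,X_n$ be independent (not necessarily identically distributed) mean-zero random vectors in $\mathbb{R}^q$ such that, for some $K_{n,q}>0$, $$\max_{1\le i\le n}\max_{1\le j\le q}\|X_i(j)\|_{\psi_\alpha}\le K_{n,q},$$ and put $\Gamma_{n,q}:=\max_{1\le j\le q}\frac1n\sum_{i=1}^n\mathbb{E}[X_i(j)^2]$. Then for every $t\ge 0$, with probability at least $1-3e^{-t}$, $$\Big\|\frac1n\sum_{i=1}^nX_i\Big\|_\infty\le 7\sqrt{\frac{\Gamma_{n,q}(t+\log q)}{n}}+\frac{C_\alpha K_{n,q}(\log(2n))^{1/\alpha}(t+\log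 q)^{1/\alpha^*}}{n},$$ where $\alpha^*:=\min\{\alpha,1\}$. -/

import Mathlib

open MeasureTheory ProbabilityTheory
open scoped ENNReal

/-- The `g`-Orlicz norm `inf {η > 0 : E[g(|Y|/η)] ≤ 1}` of a real random variable `Y` on `(Ω, P)`,
with values in `[0, ∞]` (it is `∞` when there is no such `η`). The function `g` is only evaluated
on `[0, ∞)`, where it is understood to be nonnegative; the expectation of the nonnegative variable
`g(|Y|/η)` is a Lebesgue integral with values in `[0, ∞]`. -/
noncomputable def orliczNorm {Ω : Type*} [MeasurableSpace Ω] (P : Measure Ω)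
    (g : ℝ → ℝ) (Y : Ω → ℝ) : ℝ≥0∞ :=
  ⨅ (η : ℝ) (_ : 0 < η) (_ : ∫⁻ ω, ENNReal.ofReal (g (|Y ω| / η)) ∂P ≤ 1), ENNReal.ofReal η

/-- `ψ_α(x) = exp(x ^ α) - 1` for `x ≥ 0`. -/
noncomputable def psi (α : ℝ) (x : ℝ) : ℝ := Real.exp (x ^ α) - 1

/-- `Γ_{n,q} = max_j (1/n) ∑_i E[X_i(j)²]`, the maximal average coordinate variance. -/
noncomputable def maxAvgVariance {Ω : Type*} [MeasurableSpace Ω] (P : Measure Ω) {n q : ℕ}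
    (X : Fin n → Ω → (Fin q → ℝ)) : ℝ :=
  ⨆ j : Fin q, (1 / (n : ℝ)) * ∑ i : Fin n, ∫ ω, (X i ω j) ^ 2 ∂P

/-!
By the union bound over the coordinates, with `s = t + log q`, it is enough to bound the sum of the
`n` real variables `X i j`, for a fixed `j`, with probability `1 - 3 * exp (-s)`; here `t ≥ 1`, since
otherwise the claim is void. After division by `2 * K` these become independent centred variables
`ξ i` with `E exp (|ξ i| ^ α) ≤ 2`.

They are truncated at the level `m` for which `2 * exp (-m ^ α / 2) = 1 / n`, so that `m` is a
constant times `(log (2 n)) ^ (1 / α)`.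

* The truncated variables are bounded by `m`, and their second moments are at most those of `ξ i`.
  Since the `ξ i` are centred, truncation shifts the mean of the sum by at most a constant
  (`abs_integral_trunc_le`). A Bernstein bound (`measureReal_bernstein_le`), applied to the truncated
  variables and to their negatives, gives the variance term and a multiple of `m * s`.
* The remainders `r i = |ξ i| * 1_{|ξ i| > m}` satisfy `(∑ r i) ^ a ≤ ∑ r i ^ a` for
  `a = min α 1`, and `E exp (r i ^ a / 2) ≤ 1 + O(1 / n)` by the choice of `m`. The exponential
  Markov inequality therefore gives `∑ r i ≤ (2 (s + 2)) ^ (1 / a)` outside an event of probability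
  `exp (-s)` (`measureReal_sum_sub_trunc_le`).
-/

/-! ### Pointwise inequalities for truncation -/

/-- The two-sided truncation of `x` at level `m`: it is `x` if `|x| ≤ m`, and `0` otherwise. -/
noncomputable def trunc (m x : ℝ) : ℝ := if |x| ≤ m then x else 0

lemma measurable_trunc (m : ℝ) : Measurable (trunc m) :=
  Measurable.ite (measurableSet_le measurable_norm measurable_const) measurable_id measurable_const

lemma abs_trunc_le {m : ℝ} (hm : 0 ≤ m) (x : ℝ) : |trunc m x| ≤ m := by
  unfold trunc; split_ifs with h <;> simp [*]

lemma sq_trunc_le (m x : ℝ) : trunc m x ^ 2 ≤ x ^ 2 := by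
  unfold trunc; split_ifs with h <;> simp [sq_nonneg]

/-- Powers are dominated by exponentials: apply `y ≤ exp y` to `y = α x ^ α / 2`. -/
lemma le_const_mul_exp_rpow {α : ℝ} (hα : 0 < α) {x : ℝ} (hx : 0 ≤ x) :
    x ≤ (2 / α) ^ (1 / α) * Real.exp (x ^ α / 2) := by
  have hu : 0 ≤ x ^ α := Real.rpow_nonneg hx α
  have h1 : α / 2 * x ^ α ≤ Real.exp (α / 2 * x ^ α) := by
    linarith [Real.add_one_le_exp (α / 2 * x ^ α)]
  have h2 : x ^ α ≤ 2 / α * Real.exp (α / 2 * x ^ α) := by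
    calc x ^ α = 2 / α * (α / 2 * x ^ α) := by field_simp
      _ ≤ _ := by gcongr
  calc x = (x ^ α) ^ (1 / α) := by
        rw [← Real.rpow_mul hx, mul_one_div_cancel hα.ne', Real.rpow_one]
    _ ≤ (2 / α * Real.exp (α / 2 * x ^ α)) ^ (1 / α) := by gcongr
    _ = _ := by
        rw [Real.mul_rpow (by positivity) (by positivity), ← Real.exp_mul]
        congr 2
        field_simp

/-- Above the truncation level, half of the exponent of `exp (|x| ^ α)` can be traded for the small
factor `exp (-m ^ α / 2)`. -/
lemma exp_half_rpow_le {α : ℝ} (hα : 0 < α) {m x : ℝ} (hm : 0 ≤ m) (hx : m ≤ |x|) :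
    Real.exp (|x| ^ α / 2) ≤ Real.exp (-(m ^ α / 2)) * Real.exp (|x| ^ α) := by
  rw [← Real.exp_add]
  have : m ^ α ≤ |x| ^ α := by gcongr
  gcongr
  linarith

lemma abs_sub_trunc_le {α : ℝ} (hα : 0 < α) {m : ℝ} (hm : 0 ≤ m) (x : ℝ) :
    |x - trunc m x| ≤
      (2 / α) ^ (1 / α) * Real.exp (-(m ^ α / 2)) * Real.exp (|x| ^ α) := by
  unfold trunc
  split_ifs with h
  · simp only [sub_self, abs_zero]; positivity
  · rw [sub_zero, mul_assoc]
    refine (le_const_mul_exp_rpow hα (abs_nonneg x)).trans ?_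
    gcongr
    exact exp_half_rpow_le hα hm (not_le.1 h).le

lemma rpow_min_one_le {α : ℝ} (hα : 0 < α) {x : ℝ} (hx : 0 ≤ x) :
    x ^ min α 1 ≤ 1 + x ^ α := by
  have h0 : 0 ≤ x ^ α := Real.rpow_nonneg hx α
  rcases le_total x 1 with h | h
  · linarith [Real.rpow_le_one hx h (lt_min hα one_pos).le]
  · linarith [Real.rpow_le_rpow_of_exponent_le h (min_le_left α 1)]

lemma exp_half_rpow_sub_trunc_le {α : ℝ} (hα : 0 < α) {m : ℝ} (hm : 0 ≤ m) (x : ℝ) :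
    Real.exp (1 / 2 * |x - trunc m x| ^ min α 1) ≤
      1 + Real.exp (1 / 2) * Real.exp (-(m ^ α / 2)) * Real.exp (|x| ^ α) := by
  unfold trunc
  split_ifs with h
  · rw [sub_self, abs_zero, Real.zero_rpow (lt_min hα one_pos).ne', mul_zero, Real.exp_zero]
    linarith [show 0 ≤ Real.exp (1 / 2) * Real.exp (-(m ^ α / 2)) * Real.exp (|x| ^ α) by
      positivity]
  · rw [sub_zero]
    calc Real.exp (1 / 2 * |x| ^ min α 1) ≤ Real.exp (1 / 2 + |x| ^ α / 2) := by
          gcongr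
          linarith [rpow_min_one_le hα (abs_nonneg x)]
      _ = Real.exp (1 / 2) * Real.exp (|x| ^ α / 2) := Real.exp_add _ _
      _ ≤ Real.exp (1 / 2) * (Real.exp (-(m ^ α / 2)) * Real.exp (|x| ^ α)) := by
          gcongr
          exact exp_half_rpow_le hα hm (not_le.1 h).le
      _ ≤ _ := by rw [← mul_assoc]; linarith

lemma rpow_sum_le_sum_rpow {ι : Type*} (s : Finset ι) {f : ι → ℝ} (hf : ∀ i, 0 ≤ f i) {a : ℝ}
    (ha : 0 < a) (ha1 : a ≤ 1) : (∑ i ∈ s, f i) ^ a ≤ ∑ i ∈ s, f i ^ a :=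
  Finset.le_sum_of_subadditive_on_pred (· ^ a) (0 ≤ ·) (Real.zero_rpow ha.ne').le
    (fun _ _ hx hy => Real.rpow_add_le_add_rpow hx hy ha.le ha1)
    (fun _ _ hx hy => add_nonneg hx hy) f (fun i _ => hf i)

/-! ### Chernoff bounds for sums of independent variables -/

section Chernoff

variable {Ω : Type*} [MeasurableSpace Ω] {P : Measure Ω} [IsProbabilityMeasure P]
  {ι : Type*} [Fintype ι] {Z : ι → Ω → ℝ}

lemma measureReal_ge_sum_le_exp (hZ : ∀ i, Measurable (Z i)) (hind : iIndepFun Z P) {l : ℝ}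
    (hl : 0 ≤ l) (hint : ∀ i, Integrable (fun ω => Real.exp (l * Z i ω)) P) {c : ι → ℝ}
    (hc : ∀ i, ∫ ω, Real.exp (l * Z i ω) ∂P ≤ Real.exp (c i)) (u : ℝ) :
    P.real {ω | u ≤ ∑ i, Z i ω} ≤ Real.exp (-l * u + ∑ i, c i) := by
  have h1 := measure_ge_le_exp_mul_mgf u hl
    (hind.integrable_exp_mul_sum hZ (s := Finset.univ) fun i _ => hint i)
  rw [hind.mgf_sum hZ] at h1
  simp only [Finset.sum_apply] at h1
  refine h1.trans ?_
  rw [Real.exp_add, Real.exp_sum]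
  gcongr with i
  · intro i _; exact mgf_nonneg
  · exact hc i

/-- A one-sided Bernstein bound. The variables need not be centred: an upper bound `B` on the sum of
their means enters the deviation. -/
lemma measureReal_bernstein_le (hZ : ∀ i, Measurable (Z i)) (hind : iIndepFun Z P) {m : ℝ}
    (hm : 0 < m) (hbd : ∀ i ω, |Z i ω| ≤ m) {B V : ℝ} (hB : ∑ i, ∫ ω, Z i ω ∂P ≤ B)
    (hV : ∑ i, ∫ ω, Z i ω ^ 2 ∂P ≤ V) {s : ℝ} (hs : 0 ≤ s) :
    P.real {ω | B + 2 * √(V * s) + 2 * m * s ≤ ∑ i, Z i ω} ≤ Real.exp (-s) := by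
  have hV0 : 0 ≤ V := (Finset.sum_nonneg fun i _ => integral_nonneg fun ω => sq_nonneg _).trans hV
  have hZi : ∀ i, Integrable (Z i) P := fun i =>
    Integrable.of_bound (hZ i).aestronglyMeasurable m (.of_forall fun ω => hbd i ω)
  have hZ2 : ∀ i, Integrable (fun ω => Z i ω ^ 2) P := fun i =>
    Integrable.of_bound ((hZ i).pow_const 2).aestronglyMeasurable (m ^ 2) (.of_forall fun ω => by
      rw [Real.norm_eq_abs, abs_pow]
      gcongr
      exact hbd i ω)
  -- For `l ≤ 1 / m`, the inequality `exp y ≤ 1 + y + y ^ 2` on `[-1, 1]` bounds each factor.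
  have key : ∀ l : ℝ, 0 ≤ l → l * m ≤ 1 → ∀ u : ℝ,
      P.real {ω | u ≤ ∑ i, Z i ω} ≤ Real.exp (-l * u + (l * B + l ^ 2 * V)) := by
    intro l hl hlm u
    have hpt : ∀ i ω, Real.exp (l * Z i ω) ≤ 1 + l * Z i ω + l ^ 2 * Z i ω ^ 2 := by
      intro i ω
      have h : |l * Z i ω| ≤ 1 := by
        rw [abs_mul, abs_of_nonneg hl]
        exact (mul_le_mul_of_nonneg_left (hbd i ω) hl).trans hlm
      have := (abs_le.1 (Real.abs_exp_sub_one_sub_id_le h)).2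
      rw [mul_pow] at this
      linarith
    have hint1 : ∀ i, Integrable (fun ω => 1 + l * Z i ω) P := fun i =>
      (integrable_const 1).add ((hZi i).const_mul l)
    have hint2 : ∀ i, Integrable (fun ω => 1 + l * Z i ω + l ^ 2 * Z i ω ^ 2) P := fun i =>
      (hint1 i).add ((hZ2 i).const_mul (l ^ 2))
    have hint : ∀ i, Integrable (fun ω => Real.exp (l * Z i ω)) P := fun i =>
      integrable_exp_mul_of_mem_Icc (hZ i).aemeasurable
        (.of_forall fun ω => abs_le.1 (hbd i ω))
    refine (measureReal_ge_sum_le_exp hZ hind hl hint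
      (c := fun i => l * ∫ ω, Z i ω ∂P + l ^ 2 * ∫ ω, Z i ω ^ 2 ∂P) (fun i => ?_) u).trans ?_
    · refine (integral_mono (hint i) (hint2 i) (hpt i)).trans ?_
      rw [integral_add (hint1 i) ((hZ2 i).const_mul _),
        integral_add (integrable_const 1) ((hZi i).const_mul l), integral_const_mul,
        integral_const_mul, integral_const, probReal_univ, one_smul]
      refine le_trans (le_of_eq (by ring)) (Real.add_one_le_exp _)
    · rw [Finset.sum_add_distrib, ← Finset.mul_sum, ← Finset.mul_sum]
      gcongr
  have hsq : √(V * s) ^ 2 = V * s := Real.sq_sqrt (by positivity)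
  -- The optimal `l` is `√(s / V)` when that is at most `1 / m`, and `1 / m` otherwise.
  by_cases hc : s * m ^ 2 < V
  · have hV1 : 0 < V := lt_of_le_of_lt (by positivity) hc
    have hl2 : √(s / V) ^ 2 = s / V := Real.sq_sqrt (by positivity)
    have hprod : √(s / V) * √(V * s) = s := by
      rw [← Real.sqrt_mul (by positivity), show s / V * (V * s) = s ^ 2 by field_simp,
        Real.sqrt_sq hs]
    refine (key √(s / V) (Real.sqrt_nonneg _) ?_ _).trans (Real.exp_le_exp.2 ?_)
    · rw [← abs_of_nonneg (mul_nonneg (Real.sqrt_nonneg (s / V)) hm.le), ← sq_le_one_iff_abs_le_one,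
        mul_pow, hl2, div_mul_eq_mul_div, div_le_one hV1]
      exact hc.le
    · have h3 : √(s / V) ^ 2 * V = s := by rw [hl2]; field_simp
      have h4 : 0 ≤ √(s / V) * (m * s) := by positivity
      nlinarith
  · refine (key (1 / m) (by positivity) (by field_simp; rfl) _).trans (Real.exp_le_exp.2 ?_)
    have h5 : (1 / m) ^ 2 * V ≤ s := by
      rw [one_div, inv_pow, inv_mul_le_iff₀ (by positivity)]
      linarith
    have h6 : (1 / m) * (2 * m * s) = 2 * s := by field_simp
    have h7 : 0 ≤ 1 / m * √(V * s) := by positivity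
    nlinarith

end Chernoff

/-! ### The scalar deviation inequality -/

/-- The constant of the scalar inequality: twice the constant of the truncation level, plus the bias
of the truncation and the contribution of the large values, both divided by the lower bound
`(log 2) ^ (1 / α)` of the logarithmic factor. -/
noncomputable def devConst (α : ℝ) : ℝ :=
  2 * 2 ^ (1 / α) + ((2 / α) ^ (1 / α) + 6 ^ (1 / min α 1)) / Real.log 2 ^ (1 / α)

lemma devConst_pos {α : ℝ} (hα : 0 < α) : 0 < devConst α := by
  have := Real.log_pos one_lt_two
  unfold devConst
  positivity

section Scalar

variable {Ω : Type*} [MeasurableSpace Ω] {P : Measure Ω} {ι : Type*} [Fintype ι]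
  {ξ : ι → Ω → ℝ} {α : ℝ}

lemma integrable_of_integrable_exp_rpow (hα : 0 < α) {Y : Ω → ℝ} (hY : Measurable Y)
    (h : Integrable (fun ω => Real.exp (|Y ω| ^ α)) P) : Integrable Y P := by
  refine (h.const_mul ((2 / α) ^ (1 / α))).mono' hY.aestronglyMeasurable (.of_forall fun ω => ?_)
  refine (le_const_mul_exp_rpow hα (norm_nonneg (Y ω))).trans ?_
  have : 0 ≤ |Y ω| ^ α := by positivity
  gcongr
  simpa using by linarith

lemma integrable_sq_of_integrable_exp_rpow (hα : 0 < α) {Y : Ω → ℝ} (hY : Measurable Y)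
    (h : Integrable (fun ω => Real.exp (|Y ω| ^ α)) P) : Integrable (fun ω => Y ω ^ 2) P := by
  refine (h.const_mul (((2 / α) ^ (1 / α)) ^ 2)).mono' (hY.pow_const 2).aestronglyMeasurable
    (.of_forall fun ω => ?_)
  rw [Real.norm_eq_abs, abs_pow]
  have h2 := pow_le_pow_left₀ (abs_nonneg (Y ω)) (le_const_mul_exp_rpow hα (abs_nonneg (Y ω))) 2
  rwa [mul_pow, ← Real.exp_nat_mul, Nat.cast_ofNat, mul_div_cancel₀ _ two_ne_zero] at h2

variable [IsProbabilityMeasure P]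

/-- The truncation moves the mean of a centred variable by at most an exponentially small amount. -/
lemma abs_integral_trunc_le (hα : 0 < α) {Y : Ω → ℝ} (hY : Measurable Y)
    (h : Integrable (fun ω => Real.exp (|Y ω| ^ α)) P)
    (h2 : ∫ ω, Real.exp (|Y ω| ^ α) ∂P ≤ 2) (h0 : ∫ ω, Y ω ∂P = 0) {m : ℝ} (hm : 0 ≤ m) :
    |∫ ω, trunc m (Y ω) ∂P| ≤ (2 / α) ^ (1 / α) * (2 * Real.exp (-(m ^ α / 2))) := by
  have hY1 := integrable_of_integrable_exp_rpow hα hY h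
  have hT : Integrable (fun ω => trunc m (Y ω)) P :=
    Integrable.of_bound ((measurable_trunc m).comp hY).aestronglyMeasurable m
      (.of_forall fun ω => abs_trunc_le hm _)
  calc |∫ ω, trunc m (Y ω) ∂P| = |∫ ω, (Y ω - trunc m (Y ω)) ∂P| := by
        rw [integral_sub hY1 hT, h0, zero_sub, abs_neg]
    _ ≤ ∫ ω, |Y ω - trunc m (Y ω)| ∂P := abs_integral_le_integral_abs
    _ ≤ ∫ ω, (2 / α) ^ (1 / α) * Real.exp (-(m ^ α / 2)) * Real.exp (|Y ω| ^ α) ∂P :=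
        integral_mono (hY1.sub hT).abs (h.const_mul _) fun ω => abs_sub_trunc_le hα hm _
    _ ≤ (2 / α) ^ (1 / α) * Real.exp (-(m ^ α / 2)) * 2 := by
        rw [integral_const_mul]
        gcongr
    _ = _ := by ring

/-- The sum of the values above the truncation level is controlled through its power
`min α 1 ≤ 1`, which is subadditive and whose exponential moment is close to `1`. -/
lemma measureReal_sum_sub_trunc_le (hα : 0 < α) (hξ : ∀ i, Measurable (ξ i))
    (hind : iIndepFun ξ P) (h : ∀ i, Integrable (fun ω => Real.exp (|ξ i ω| ^ α)) P)
    (h2 : ∀ i, ∫ ω, Real.exp (|ξ i ω| ^ α) ∂P ≤ 2) {m : ℝ} (hm : 0 ≤ m)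
    (hcard : Fintype.card ι * (2 * Real.exp (-(m ^ α / 2))) ≤ 1) {s : ℝ} (hs : 0 ≤ s) :
    P.real {ω | (2 * (s + 2)) ^ (1 / min α 1) ≤ ∑ i, |ξ i ω - trunc m (ξ i ω)|} ≤
      Real.exp (-s) := by
  have ha : 0 < min α 1 := lt_min hα one_pos
  set g : ℝ → ℝ := fun x => |x - trunc m x| ^ min α 1 with hg
  have hgm : Measurable g := ((measurable_id.sub (measurable_trunc m)).abs).pow_const _
  have hint2 : ∀ i, Integrable (fun ω => 1 + Real.exp (1 / 2) * Real.exp (-(m ^ α / 2)) *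
      Real.exp (|ξ i ω| ^ α)) P := fun i => (integrable_const 1).add ((h i).const_mul _)
  have hint : ∀ i, Integrable (fun ω => Real.exp (1 / 2 * g (ξ i ω))) P := fun i =>
    (hint2 i).mono' (((hgm.comp (hξ i)).const_mul _).exp).aestronglyMeasurable
      (.of_forall fun ω => by
        rw [Real.norm_eq_abs, Real.abs_exp]
        exact exp_half_rpow_sub_trunc_le hα hm _)
  have hch := measureReal_ge_sum_le_exp (Z := fun i ω => g (ξ i ω)) (fun i => hgm.comp (hξ i))
    (hind.comp (fun _ => g) fun _ => hgm) (l := 1 / 2) (by norm_num) hint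
    (c := fun _ => Real.exp (1 / 2) * (2 * Real.exp (-(m ^ α / 2)))) (fun i => ?_) (2 * (s + 2))
  · refine (measureReal_mono fun ω hω => ?_).trans (hch.trans (Real.exp_le_exp.2 ?_))
    · simp only [Set.mem_ofPred_eq] at hω ⊢
      have hs2 : 0 ≤ 2 * (s + 2) := by positivity
      calc 2 * (s + 2) = ((2 * (s + 2)) ^ (1 / min α 1)) ^ min α 1 := by
            rw [← Real.rpow_mul hs2, one_div_mul_cancel ha.ne', Real.rpow_one]
        _ ≤ (∑ i, |ξ i ω - trunc m (ξ i ω)|) ^ min α 1 := by gcongr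
        _ ≤ _ := rpow_sum_le_sum_rpow _ (fun i => abs_nonneg _) ha (min_le_right _ _)
    · have he : Real.exp (1 / 2) ≤ 2 := by
        have h1 : Real.exp (1 / 2) ^ 2 = Real.exp 1 := by rw [← Real.exp_nat_mul]; norm_num
        nlinarith [Real.exp_one_lt_d9, Real.exp_pos (1 / 2)]
      rw [Finset.sum_const, nsmul_eq_mul, Finset.card_univ, mul_left_comm]
      nlinarith [Real.exp_pos (1 / 2)]
  · refine (integral_mono (hint i) (hint2 i) fun ω =>
      exp_half_rpow_sub_trunc_le hα hm (ξ i ω)).trans ?_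
    rw [integral_add (integrable_const 1) ((h i).const_mul _), integral_const_mul, integral_const,
      probReal_univ, one_smul]
    refine le_trans ?_ (Real.add_one_le_exp _)
    have := mul_le_mul_of_nonneg_left (h2 i)
      (show 0 ≤ Real.exp (1 / 2) * Real.exp (-(m ^ α / 2)) by positivity)
    linarith

/-- The two-sided scalar inequality for variables normalized by `E exp (|ξ i| ^ α) ≤ 2`. -/
theorem measureReal_sum_gt_le (hα : 0 < α) [Nonempty ι] (hξ : ∀ i, Measurable (ξ i))
    (hind : iIndepFun ξ P) (h : ∀ i, Integrable (fun ω => Real.exp (|ξ i ω| ^ α)) P)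
    (h2 : ∀ i, ∫ ω, Real.exp (|ξ i ω| ^ α) ∂P ≤ 2) (h0 : ∀ i, ∫ ω, ξ i ω ∂P = 0) {s : ℝ}
    (hs : 1 ≤ s) :
    P.real {ω | 2 * √((∑ i, ∫ ω, ξ i ω ^ 2 ∂P) * s) + devConst α *
        Real.log (2 * Fintype.card ι) ^ (1 / α) * s ^ (1 / min α 1) < |∑ i, ξ i ω|} ≤
      3 * Real.exp (-s) := by
  have ha : 0 < min α 1 := lt_min hα one_pos
  have hs0 : 0 ≤ s := by linarith
  have hn : (1 : ℝ) ≤ Fintype.card ι := by exact_mod_cast Fintype.card_pos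
  have hlog2 := Real.log_pos one_lt_two
  set n : ℝ := (Fintype.card ι : ℝ)
  set L : ℝ := Real.log (2 * n)
  have hL2 : Real.log 2 ≤ L := Real.log_le_log two_pos (by linarith)
  have hL : 0 < L := hlog2.trans_le hL2
  -- The truncation level is chosen so that `2 * exp (-m ^ α / 2) = 1 / n`.
  set m : ℝ := (2 * L) ^ (1 / α) with hmdef
  have hm : 0 < m := by positivity
  have hmexp : n * (2 * Real.exp (-(m ^ α / 2))) = 1 := by
    rw [hmdef, ← Real.rpow_mul (by positivity), one_div_mul_cancel hα.ne', Real.rpow_one,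
      mul_div_cancel_left₀ _ two_ne_zero, Real.exp_neg, Real.exp_log (by positivity)]
    field_simp
  set V : ℝ := ∑ i, ∫ ω, ξ i ω ^ 2 ∂P
  set B : ℝ := (2 / α) ^ (1 / α)
  set R : ℝ := (2 * (s + 2)) ^ (1 / min α 1) with hRdef
  have hbias : ∑ i, |∫ ω, trunc m (ξ i ω) ∂P| ≤ B := by
    calc _ ≤ ∑ _i : ι, B * (2 * Real.exp (-(m ^ α / 2))) :=
          Finset.sum_le_sum fun i _ => abs_integral_trunc_le hα (hξ i) (h i) (h2 i) (h0 i) hm.le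
      _ = B * (n * (2 * Real.exp (-(m ^ α / 2)))) := by
          rw [Finset.sum_const, nsmul_eq_mul, Finset.card_univ]; ring
      _ = B := by rw [hmexp, mul_one]
  have hvar : ∑ i, ∫ ω, trunc m (ξ i ω) ^ 2 ∂P ≤ V :=
    Finset.sum_le_sum fun i _ => integral_mono_of_nonneg (.of_forall fun ω => sq_nonneg _)
      (integrable_sq_of_integrable_exp_rpow hα (hξ i) (h i)) (.of_forall fun ω => sq_trunc_le _ _)
  have hup := measureReal_bernstein_le (Z := fun i ω => trunc m (ξ i ω))
    (fun i => (measurable_trunc m).comp (hξ i))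
    (hind.comp (fun _ => trunc m) fun _ => measurable_trunc m) hm (fun i ω => abs_trunc_le hm.le _)
    ((Finset.sum_le_sum fun i _ => le_abs_self _).trans hbias) hvar hs0
  have hlow := measureReal_bernstein_le (Z := fun i ω => -trunc m (ξ i ω))
    (fun i => ((measurable_trunc m).comp (hξ i)).neg)
    (hind.comp (fun _ x => -trunc m x) fun _ => (measurable_trunc m).neg) hm
    (fun i ω => by rw [abs_neg]; exact abs_trunc_le hm.le _) (B := B) (V := V)
    ((Finset.sum_le_sum fun i _ => by rw [integral_neg]; exact neg_le_abs _).trans hbias)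
    (by simpa only [neg_sq] using hvar) hs0
  have htail := measureReal_sum_sub_trunc_le hα hξ hind h h2 hm.le hmexp.le hs0
  -- The three error terms are absorbed into `devConst α`.
  have hconst : B + 2 * m * s + R ≤ devConst α * L ^ (1 / α) * s ^ (1 / min α 1) := by
    have hs1 : s ≤ s ^ (1 / min α 1) :=
      Real.self_le_rpow_of_one_le hs ((one_le_div ha).2 (min_le_right _ _))
    have hone : 1 ≤ s ^ (1 / min α 1) := hs.trans hs1
    have hB : 0 ≤ B := by positivity
    have h6 : (0 : ℝ) ≤ 6 ^ (1 / min α 1) := by positivity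
    -- The `6` comes from `2 * (s + 2) ≤ 6 * s`, valid as `1 ≤ s`.
    have hR : R ≤ 6 ^ (1 / min α 1) * s ^ (1 / min α 1) := by
      rw [hRdef, ← Real.mul_rpow (by norm_num) hs0]
      exact Real.rpow_le_rpow (by positivity) (by linarith) (by positivity)
    have hmm : m = 2 ^ (1 / α) * L ^ (1 / α) := Real.mul_rpow two_pos.le hL.le
    have hratio : 1 ≤ L ^ (1 / α) / Real.log 2 ^ (1 / α) := by
      rw [one_le_div (by positivity)]; gcongr
    calc B + 2 * m * s + R
        ≤ B * s ^ (1 / min α 1) + 2 * m * s ^ (1 / min α 1)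
          + 6 ^ (1 / min α 1) * s ^ (1 / min α 1) := by
          gcongr
          exact le_mul_of_one_le_right hB hone
      _ = (2 * m + (B + 6 ^ (1 / min α 1)) * 1) * s ^ (1 / min α 1) := by ring
      _ ≤ (2 * m + (B + 6 ^ (1 / min α 1)) * (L ^ (1 / α) / Real.log 2 ^ (1 / α)))
          * s ^ (1 / min α 1) := by gcongr
      _ = _ := by rw [hmm, devConst]; ring
  calc _ ≤ P.real (({ω | B + 2 * √(V * s) + 2 * m * s ≤ ∑ i, trunc m (ξ i ω)} ∪
          {ω | B + 2 * √(V * s) + 2 * m * s ≤ ∑ i, -trunc m (ξ i ω)}) ∪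
          {ω | R ≤ ∑ i, |ξ i ω - trunc m (ξ i ω)|}) := by
        refine measureReal_mono fun ω hω => ?_
        simp only [Set.mem_ofPred_eq, Set.mem_union] at hω ⊢
        by_contra! hcon
        obtain ⟨⟨hc1, hc2⟩, hc3⟩ := hcon
        rw [Finset.sum_neg_distrib] at hc2
        have hsplit : ∑ i, ξ i ω = ∑ i, trunc m (ξ i ω) + ∑ i, (ξ i ω - trunc m (ξ i ω)) := by
          rw [← Finset.sum_add_distrib]; simp
        have h7 : |∑ i, trunc m (ξ i ω)| ≤ B + 2 * √(V * s) + 2 * m * s :=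
          abs_le.2 ⟨by linarith, hc1.le⟩
        have h8 := Finset.abs_sum_le_sum_abs (fun i => ξ i ω - trunc m (ξ i ω)) Finset.univ
        have h9 := abs_add_le (∑ i, trunc m (ξ i ω)) (∑ i, (ξ i ω - trunc m (ξ i ω)))
        rw [hsplit] at hω
        linarith
    _ ≤ (Real.exp (-s) + Real.exp (-s)) + Real.exp (-s) :=
        (measureReal_union_le _ _).trans
          (add_le_add ((measureReal_union_le _ _).trans (add_le_add hup hlow)) htail)
    _ = _ := by ring

end Scalar

/-! ### Orlicz norms and the union bound over coordinates -/

/-- A variable whose `ψ_α`-norm is less than `K` satisfies `E exp (|Y / K| ^ α) ≤ 2`. -/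
lemma integrable_exp_rpow_of_orliczNorm_lt {Ω : Type*} [MeasurableSpace Ω] {P : Measure Ω}
    [IsProbabilityMeasure P] {α : ℝ} (hα : 0 < α) {Y : Ω → ℝ} (hY : Measurable Y) {K : ℝ}
    (h : orliczNorm P (psi α) Y < ENNReal.ofReal K) :
    Integrable (fun ω => Real.exp (|Y ω / K| ^ α)) P ∧
      ∫ ω, Real.exp (|Y ω / K| ^ α) ∂P ≤ 2 := by
  simp only [orliczNorm, iInf_lt_iff] at h
  obtain ⟨η, hη, hle, hlt⟩ := h
  have hηK : η < K := (ENNReal.ofReal_lt_ofReal_iff_of_nonneg hη.le).1 hlt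
  have hK : 0 < K := hη.trans hηK
  have hmeas : Measurable fun ω => Real.exp (|Y ω / K| ^ α) :=
    ((hY.div_const K).abs.pow_const α).exp
  have hlin : ∫⁻ ω, ENNReal.ofReal (Real.exp (|Y ω / K| ^ α)) ∂P ≤ 2 := by
    calc _ ≤ ∫⁻ ω, (ENNReal.ofReal (psi α (|Y ω| / η)) + 1) ∂P := by
          refine lintegral_mono fun ω => ?_
          rw [← ENNReal.ofReal_one, ← ENNReal.ofReal_add _ zero_le_one]
          · rw [psi, sub_add_cancel, abs_div, abs_of_pos hK]
            gcongr
          · rw [psi, sub_nonneg, Real.one_le_exp_iff]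
            positivity
      _ = ∫⁻ ω, ENNReal.ofReal (psi α (|Y ω| / η)) ∂P + 1 := by
          rw [lintegral_add_right _ measurable_const]; simp
      _ ≤ 1 + 1 := by gcongr
      _ = 2 := one_add_one_eq_two
  refine ⟨⟨hmeas.aestronglyMeasurable, ?_⟩, ?_⟩
  · rw [hasFiniteIntegral_iff_ofReal (.of_forall fun ω => (Real.exp_pos _).le)]
    exact hlin.trans_lt ENNReal.ofNat_lt_top
  · rw [integral_eq_lintegral_of_nonneg_ae (.of_forall fun ω => (Real.exp_pos _).le)
      hmeas.aestronglyMeasurable]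
    exact ENNReal.toReal_le_of_le_ofReal two_pos.le (by simpa using hlin)

/-- The bound for one coordinate, obtained by applying the scalar inequality to `Y i / (2 * K)`; the
factor `2` makes the inequality for the Orlicz norm strict. -/
lemma measureReal_sum_gt_le_of_orliczNorm_le {Ω : Type*} [MeasurableSpace Ω] {P : Measure Ω}
    [IsProbabilityMeasure P] {ι : Type*} [Fintype ι] [Nonempty ι] {α : ℝ} (hα : 0 < α)
    {Y : ι → Ω → ℝ} (hY : ∀ i, Measurable (Y i)) (hind : iIndepFun Y P)
    (h0 : ∀ i, ∫ ω, Y i ω ∂P = 0) {K : ℝ} (hK : 0 < K)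
    (hnorm : ∀ i, orliczNorm P (psi α) (Y i) ≤ ENNReal.ofReal K) {s : ℝ} (hs : 1 ≤ s) :
    P.real {ω | 2 * √((∑ i, ∫ ω, Y i ω ^ 2 ∂P) * s) + 2 * devConst α * K *
        Real.log (2 * Fintype.card ι) ^ (1 / α) * s ^ (1 / min α 1) < |∑ i, Y i ω|} ≤
      3 * Real.exp (-s) := by
  have hK2 : 0 < 2 * K := by positivity
  have hexp := fun i => integrable_exp_rpow_of_orliczNorm_lt hα (hY i) ((hnorm i).trans_lt
    ((ENNReal.ofReal_lt_ofReal_iff hK2).2 (show K < 2 * K by linarith)))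
  have hdev := measureReal_sum_gt_le hα (ξ := fun i ω => Y i ω / (2 * K))
    (fun i => (hY i).div_const _) (hind.comp (fun _ x => x / (2 * K)) fun _ =>
      measurable_id.div_const _) (fun i => (hexp i).1) (fun i => (hexp i).2)
    (fun i => by rw [integral_div, h0, zero_div]) hs
  refine le_trans (le_of_eq ?_) hdev
  congr 1
  ext ω
  have hV : ∑ i, ∫ ω, (Y i ω / (2 * K)) ^ 2 ∂P = (∑ i, ∫ ω, Y i ω ^ 2 ∂P) / (2 * K) ^ 2 := by
    simp_rw [div_pow, integral_div, Finset.sum_div]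
  rw [Set.mem_ofPred_eq, Set.mem_ofPred_eq, hV, ← Finset.sum_div, abs_div, abs_of_pos hK2,
    lt_div_iff₀ hK2, div_mul_eq_mul_div, Real.sqrt_div' _ (sq_nonneg _), Real.sqrt_sq hK2.le]
  field_simp

/-- The norm on `Fin q → ℝ` is the maximum norm. -/
theorem mainTheorem1 (α : ℝ) (hα : 0 < α) :
    ∃ C : ℝ, 0 < C ∧
      ∀ {Ω : Type*} [MeasurableSpace Ω] (P : Measure Ω) [IsProbabilityMeasure P]
        (n q : ℕ) (_ : 1 ≤ n) (_ : 1 ≤ q) (X : Fin n → Ω → (Fin q → ℝ)) (K : ℝ),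
        (∀ i, Measurable (X i)) →
        iIndepFun X P →
        (∀ i, ∫ ω, X i ω ∂P = 0) →
        0 < K →
        (∀ i j, orliczNorm P (psi α) (fun ω => X i ω j) ≤ ENNReal.ofReal K) →
        ∀ t : ℝ, 0 ≤ t →
          1 - 3 * Real.exp (-t) ≤
            P.real {ω | ‖(1 / (n : ℝ)) • ∑ i : Fin n, X i ω‖ ≤
              7 * Real.sqrt (maxAvgVariance P X * (t + Real.log q) / n)
                + C * K * (Real.log (2 * n)) ^ (1 / α)
                    * (t + Real.log q) ^ (1 / min α 1) / n} := by
  refine ⟨2 * devConst α, mul_pos two_pos (devConst_pos hα), ?_⟩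
  intro Ω _ P _ n q hn hq X K hX hind h0 hK hnorm t ht
  have hn0 : (0 : ℝ) < n := by exact_mod_cast hn
  have hq0 : (0 : ℝ) < q := by exact_mod_cast hq
  -- For `t ≤ 1` the claimed probability is not positive, because `exp 1 ≤ 3`.
  rcases le_total t 1 with ht1 | ht1
  · refine le_trans ?_ measureReal_nonneg
    have h3 : Real.exp (-1) ≤ Real.exp (-t) := Real.exp_le_exp.2 (by linarith)
    have h4 : Real.exp (-1) * Real.exp 1 = 1 := by rw [← Real.exp_add]; simp
    nlinarith [Real.exp_one_lt_d9, Real.exp_pos (-1)]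
  have : Nonempty (Fin n) := ⟨⟨0, hn⟩⟩
  set s : ℝ := t + Real.log q with hsdef
  have hs : 1 ≤ s := by
    have := Real.log_nonneg (show (1 : ℝ) ≤ q by exact_mod_cast hq)
    linarith
  have hexps : Real.exp (-s) = Real.exp (-t) / q := by
    rw [hsdef, neg_add, Real.exp_add, Real.exp_neg (Real.log q), Real.exp_log hq0, div_eq_mul_inv]
  have hXj : ∀ i j, Measurable fun ω => X i ω j := fun i j => (measurable_pi_apply j).comp (hX i)
  have hint : ∀ i j, Integrable (fun ω => X i ω j) P := by
    intro i j
    have h1 := (integrable_exp_rpow_of_orliczNorm_lt hα (hXj i j) ((hnorm i j).trans_lt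
      ((ENNReal.ofReal_lt_ofReal_iff (show 0 < 2 * K by linarith)).2
        (show K < 2 * K by linarith)))).1
    have h2 := (integrable_of_integrable_exp_rpow hα ((hXj i j).div_const _) h1).mul_const (2 * K)
    simpa [hK.ne'] using h2
  have hdev := fun j => measureReal_sum_gt_le_of_orliczNorm_le hα (Y := fun i ω => X i ω j)
    (fun i => hXj i j) (hind.comp (fun _ x => x j) fun _ => measurable_pi_apply j)
    (fun i => by rw [← eval_integral (hint i), h0, Pi.zero_apply]) hK (fun i => hnorm i j) hs
  simp only [Fintype.card_fin] at hdev
  set A : ℝ := 2 * devConst α * K * Real.log (2 * n) ^ (1 / α) * s ^ (1 / min α 1)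
  have hA : 0 ≤ A := by
    have h1 := devConst_pos hα
    have h2 : 0 ≤ Real.log (2 * n) := Real.log_nonneg (by
      have : (1 : ℝ) ≤ n := by exact_mod_cast hn
      linarith)
    positivity
  set G : Set Ω := {ω | ‖(1 / (n : ℝ)) • ∑ i : Fin n, X i ω‖ ≤
    7 * √(maxAvgVariance P X * s / n) + A / n}
  have hsub : Gᶜ ⊆ ⋃ j : Fin q,
      {ω | 2 * √((∑ i, ∫ ω, X i ω j ^ 2 ∂P) * s) + A < |∑ i, X i ω j|} := by
    intro ω hω
    by_contra hcon
    simp only [Set.mem_iUnion, Set.mem_ofPred_eq, not_exists, not_lt] at hcon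
    refine hω ((pi_norm_le_iff_of_nonneg (by positivity)).2 fun j => ?_)
    have hVj : (1 / (n : ℝ)) * ∑ i, ∫ ω, X i ω j ^ 2 ∂P ≤ maxAvgVariance P X :=
      le_ciSup (f := fun j : Fin q => (1 / (n : ℝ)) * ∑ i, ∫ ω, X i ω j ^ 2 ∂P)
        (Set.finite_range _).bddAbove j
    have hsqrt : √((∑ i, ∫ ω, X i ω j ^ 2 ∂P) * s) ≤ √(maxAvgVariance P X * s / n) * n := by
      rw [← Real.sqrt_sq hn0.le, ← Real.sqrt_mul' _ (sq_nonneg _), Real.sqrt_sq hn0.le]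
      refine Real.sqrt_le_sqrt ?_
      calc _ = ((1 / (n : ℝ)) * ∑ i, ∫ ω, X i ω j ^ 2 ∂P) * s * n := by field_simp
        _ ≤ maxAvgVariance P X * s * n := by gcongr
        _ = _ := by field_simp
    rw [Pi.smul_apply, Finset.sum_apply, smul_eq_mul, Real.norm_eq_abs, abs_mul,
      abs_of_pos (by positivity : 0 < 1 / (n : ℝ)), one_div_mul_eq_div, div_le_iff₀ hn0, add_mul,
      div_mul_cancel₀ _ hn0.ne']
    have := mul_nonneg (Real.sqrt_nonneg (maxAvgVariance P X * s / n)) hn0.le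
    linarith [hcon j]
  have hcompl : P.real Gᶜ ≤ 3 * Real.exp (-t) := by
    calc P.real Gᶜ ≤ ∑ _j : Fin q, 3 * Real.exp (-s) :=
          ((measureReal_mono hsub).trans (measureReal_iUnion_fintype_le _)).trans
            (Finset.sum_le_sum fun j _ => hdev j)
      _ = 3 * Real.exp (-t) := by
          rw [Finset.sum_const, Finset.card_univ, Fintype.card_fin, nsmul_eq_mul, hexps]
          field_simp
  have hone : 1 ≤ P.real G + P.real Gᶜ := by
    rw [← probReal_univ (μ := P), ← Set.union_compl_self G]
    exact measureReal_union_le _ _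
  linarith
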